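/- Identify functions with their graphs, and let $\mathfrak c=|\mathbb R|$. Consider the condition (A) There is a function $f\colon\mathbb R\to\mathbb R$ which is the union of a family $\{f_\alpha\colon\alpha<\mathfrak c\}$ of pairwise disjoint partial functions such that each $f_\alpha\subseteq\mathbb R^2$ has positive outer (planar Lebesgue) measure and $\{x\in\mathbb R\colon f(x)=g(x)\}$ is a null set for every continuous $g\colon\mathbb R\to\mathbb R$. For $F\colon\mathbb R^2\to\mathbb R$ and $f\colon\mathbb R\to\mathbb R$ put $F_f(x)=F(x,f(x))$. The function $F$ is sup-measurable if $F_f$ is Lebesgue measurable for every Lebesgue measurable $f\colon\mathbb R\to\mathbb R$, and weakly sup-measurable if $F_f$ is Lebesgue measurable for every continuous and almost everywhere differentiable $f\colon\mathbb R\to\mathbb R$. A subset $\mathcal A$ of a commutative $\mathbb R$-algebra is strongly $\kappa$-algebrable if $\mathcal A\cup\{0\}$ contains a (not necessarily unital) subalgebra generated by a set $X$ of cardinality $\kappa$ which is a free commutative algebra with $X$ as set of free generators, i.e. is isomorphic, via $X$, to the algebra of real polynomials without constant term in the variables $X$. Assume (A). Then the family of all weakly sup-measurable functions $F\colon\mathbb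 R^2\to\mathbb R$ that are not sup-measurable is a strongly $2^{\mathfrak c}$-algebrable subset of the algebra $\mathbb R^{\mathbb R^2}$ of all functions $\mathbb R^2\to\mathbb R$ with pointwise operations. -/

import Mathlib

open MeasureTheory

/-- The Carathéodory superposition `F_f (x) = F (x, f x)`. -/
def superposition (F : ℝ × ℝ → ℝ) (f : ℝ → ℝ) : ℝ → ℝ := fun x => F (x, f x)

/-- Lebesgue measurability of `f : ℝ → ℝ`: preimages of Borel sets belong to the completion of
the Borel σ-algebra with respect to Lebesgue measure. -/
def LebesgueMeasurable (f : ℝ → ℝ) : Prop := NullMeasurable f (volume : Measure ℝ)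

/-- `F` is sup-measurable. -/
def SupMeasurable (F : ℝ × ℝ → ℝ) : Prop :=
  ∀ f : ℝ → ℝ, LebesgueMeasurable f → LebesgueMeasurable (superposition F f)

/-- `F` is weakly sup-measurable. -/
def WeaklySupMeasurable (F : ℝ × ℝ → ℝ) : Prop :=
  ∀ f : ℝ → ℝ, Continuous f → (∀ᵐ x, DifferentiableAt ℝ f x) →
    LebesgueMeasurable (superposition F f)

/-- Condition (A). Functions are identified with their graphs, so the partial functions `fα i` are
pairwise disjoint sets in the plane whose union is the graph of `f`. A Mathlib measure evaluated
at an arbitrary set is the outer measure of this set. -/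
def ConditionA : Prop :=
  ∃ (f : ℝ → ℝ) (ι : Type) (fα : ι → Set (ℝ × ℝ)),
    Cardinal.mk ι = Cardinal.continuum ∧
    Pairwise (fun i j => Disjoint (fα i) (fα j)) ∧
    (⋃ i, fα i) = {p : ℝ × ℝ | p.2 = f p.1} ∧
    (∀ i, 0 < (volume : Measure (ℝ × ℝ)) (fα i)) ∧
    ∀ g : ℝ → ℝ, Continuous g → (volume : Measure ℝ) {x | f x = g x} = 0

/-- The free commutative (not necessarily unital) `R`-algebra on `σ`: the polynomials in the
variables `σ` without constant term. -/
def freeCommAlgebra (R σ : Type*) [CommRing R] : NonUnitalSubalgebra R (MvPolynomial σ R) where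
  carrier := {P | MvPolynomial.constantCoeff P = 0}
  zero_mem' := map_zero _
  add_mem' {a b} ha hb := by
    simp only [Set.mem_ofPred_eq] at ha hb ⊢
    rw [map_add, ha, hb, add_zero]
  mul_mem' {a b} ha _ := by
    simp only [Set.mem_ofPred_eq] at ha ⊢
    rw [map_mul, ha, zero_mul]
  smul_mem' c a ha := by
    simp only [Set.mem_ofPred_eq] at ha ⊢
    rw [MvPolynomial.constantCoeff_smul, ha, smul_zero]

/-- The free generator of `freeCommAlgebra R σ` that belongs to `s : σ`. -/
noncomputable def freeCommAlgebraGen (R : Type*) {σ : Type*} [CommRing R] (s : σ) :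
    freeCommAlgebra R σ :=
  ⟨MvPolynomial.X s, MvPolynomial.constantCoeff_X R s⟩

/-- `A` is strongly `κ`-algebrable: `A ∪ {0}` contains a subalgebra, generated by a set `X` of
cardinality `κ`, that is isomorphic to the free commutative algebra with `X` as set of free
generators. Subalgebras need not contain the unit. -/
def StronglyAlgebrable.{u, v} (R : Type u) {L : Type v} [CommRing R] [CommRing L] [Algebra R L]
    (κ : Cardinal.{v}) (A : Set L) : Prop :=
  ∃ X : Set L, Cardinal.mk X = κ ∧
    (NonUnitalAlgebra.adjoin R X : Set L) ⊆ A ∪ {0} ∧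
    ∃ e : freeCommAlgebra R X →ₙₐ[R] NonUnitalAlgebra.adjoin R X, Function.Bijective e ∧
      ∀ x : X, (e (freeCommAlgebraGen R x) : L) = x

/-! Put everything on the graph of a Weierstrass function w. A continuous, a.e. differentiable g
agrees with w only on a null set (`volume_eq_weierstrass_eq_zero`), so any function supported on the
graph is weakly sup-measurable. As w is itself measurable, it suffices to spoil measurability along
it. `exists_map_fibres_meet_positive` colours ℝ with continuum many colours, each colour meeting
every measurable set of positive measure. For each of the 2^𝔠 sets A of reals, the generator at (x,
w x) depends only on the colour of x, through an independent family (`exists_traceValue_eq`). A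
nonzero polynomial without constant term in the generators is then nonzero on one colour and zero on
another, hence nonmeasurable along w. -/

open Cardinal in
/-- A family of sets, each at least as large as the index type, has an injective choice function. -/
theorem exists_injective_choice {ι α : Type} (S : ι → Set α) (hS : ∀ i, #ι ≤ #(S i)) :
    ∃ f : ι → α, Function.Injective f ∧ ∀ i, f i ∈ S i := by
  -- In a well-order of least type, initial segments are smaller than `ι`, so earlier choices cannot
  -- exhaust `S i`.
  obtain ⟨r, hr, hord⟩ := exists_ord_eq ι
  have step : ∀ (i : ι) (g : ∀ j, r j i → α), ∃ a ∈ S i, ∀ j (h : r j i), g j h ≠ a := by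
    intro i g
    have hlt : #(Set.range fun j : {j // r j i} => g j.1 j.2) < #(S i) :=
      (mk_range_le.trans_lt (card_typein_lt i hord)).trans_le (hS i)
    obtain ⟨a, ha, hna⟩ := Set.not_subset.1 fun h => hlt.not_ge (mk_le_mk_of_subset h)
    exact ⟨a, ha, fun j h e => hna ⟨⟨j, h⟩, e⟩⟩
  choose next hmem hne using step
  have wf : WellFounded r := IsWellFounded.wf
  let f : ι → α := wf.fix next
  have hf : ∀ i, f i = next i fun j _ => f j := fun i => wf.fix_eq next i
  have hlt : ∀ i j, r j i → f j ≠ f i := fun i j h => by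
    rw [hf i]
    exact hne i (fun j _ => f j) j h
  refine ⟨f, fun i j hij => ?_, fun i => ?_⟩
  · rcases trichotomous_of r i j with h | h | h
    · exact absurd hij (hlt j i h)
    · exact h
    · exact absurd hij.symm (hlt i j h)
  · rw [hf i]
    exact hmem i _

open Cardinal in
theorem continuum_le_mk_of_volume_pos {S : Set ℝ} (hS : MeasurableSet S) (hpos : 0 < volume S) :
    continuum ≤ #S := by
  have : StandardBorelSpace S := hS.standardBorel
  have hc : ¬ Countable S := fun h => hpos.ne' ((Set.countable_coe_iff.1 h).measure_zero volume)
  have hR : ¬ Countable ℝ := not_countable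
  rw [← mk_real]
  exact (mk_congr (PolishSpace.measurableEquivOfNotCountable hc hR).toEquiv).ge

open Cardinal in
/-- There is a map whose fibres all have full outer measure: each fibre is a Bernstein-type set. -/
theorem exists_map_fibres_meet_positive :
    ∃ m : ℝ → ℝ, ∀ S : Set ℝ, MeasurableSet S → 0 < volume S → ∀ c, ∃ x ∈ S, m x = c := by
  let ι := {S : Set ℝ // MeasurableSet S ∧ 0 < volume S} × ℝ
  have hS : #{S : Set ℝ // MeasurableSet S ∧ 0 < volume S} ≤ continuum := by
    have h₁ : #{S : Set ℝ | MeasurableSet S} ≤ continuum := by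
      obtain ⟨b, hb, hb'⟩ :=
        MeasurableSpace.CountablyGenerated.isCountablyGenerated (α := ℝ)
      rw [hb']
      exact MeasurableSpace.cardinal_measurableSet_le_continuum
        (hb.le_aleph0.trans aleph0_le_continuum)
    exact (mk_le_mk_of_subset fun S h => h.1).trans h₁
  have hι : #ι ≤ continuum := by
    rw [mk_prod, lift_id, lift_id, mk_real]
    exact (mul_le_mul_left hS _).trans continuum_mul_self.le
  obtain ⟨f, hf, hmem⟩ := exists_injective_choice (fun i : ι => i.1.1) fun i =>
    hι.trans (continuum_le_mk_of_volume_pos i.1.2.1 i.1.2.2)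
  -- The point chosen in `S` for the pair `(S, c)` gets colour `c`; injectivity prevents conflicts.
  refine ⟨Function.extend f Prod.snd 0, fun S hS hpos c => ?_⟩
  let i : ι := ⟨⟨S, hS, hpos⟩, c⟩
  exact ⟨f i, hmem i, hf.extend_apply _ _ i⟩

/-! ### An independent family of size 2^𝔠 -/

/-- For pairwise distinct sets of reals, these functions of `(T, v)` take arbitrary values
simultaneously. -/
noncomputable def traceValue (A : Set ℝ) (j : Finset ℝ × (Finset ℝ →₀ ℝ)) : ℝ :=
  open Classical in j.2 (j.1.filter (· ∈ A))

/-- A finite `T` separating the members of `V` gives them distinct traces `T ∩ A`, on which values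
can be prescribed freely. -/
theorem exists_traceValue_eq (V : Finset (Set ℝ)) (z : Set ℝ → ℝ) :
    ∃ j, ∀ A ∈ V, traceValue A j = z A := by
  classical
  have hd : ∀ A B : Set ℝ, ∃ x, A ≠ B → ¬ (x ∈ A ↔ x ∈ B) := by
    intro A B
    by_contra! h
    exact (h 0).1 (Set.ext fun x => (h x).2)
  choose d hd using hd
  let T : Finset ℝ := (V ×ˢ V).image fun p => d p.1 p.2
  have hT : ∀ A ∈ V, ∀ B ∈ V, A ≠ B → T.filter (· ∈ A) ≠ T.filter (· ∈ B) := by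
    intro A hA B hB hAB h
    have hm : d A B ∈ T := Finset.mem_image.2 ⟨(A, B), Finset.mem_product.2 ⟨hA, hB⟩, rfl⟩
    have := Finset.ext_iff.1 h (d A B)
    simp only [Finset.mem_filter, hm, true_and] at this
    exact hd A B hAB this
  refine ⟨(T, ∑ A ∈ V, Finsupp.single (T.filter (· ∈ A)) (z A)), fun A hA => ?_⟩
  have : traceValue A (T, ∑ A ∈ V, Finsupp.single (T.filter (· ∈ A)) (z A)) =
      (∑ B ∈ V, Finsupp.single (T.filter (· ∈ B)) (z B)) (T.filter (· ∈ A)) := by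
    unfold traceValue
    congr
  rw [this, Finsupp.finsetSum_apply, Finset.sum_eq_single A]
  · exact Finsupp.single_eq_same
  · intro B hB hBA
    exact Finsupp.single_eq_of_ne (hT A hA B hB hBA.symm)
  · exact fun h => absurd hA h

theorem exists_eval_traceValue_ne_zero {P : MvPolynomial (Set ℝ) ℝ} (hP : P ≠ 0) :
    ∃ j, MvPolynomial.eval (fun A => traceValue A j) P ≠ 0 := by
  obtain ⟨z, hz⟩ : ∃ z : Set ℝ → ℝ, MvPolynomial.eval z P ≠ 0 := by
    by_contra! h
    exact hP (MvPolynomial.funext fun z => by rw [h z, map_zero])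
  obtain ⟨j, hj⟩ := exists_traceValue_eq P.vars z
  refine ⟨j, ?_⟩
  rwa [show MvPolynomial.eval (fun A => traceValue A j) P = MvPolynomial.eval z P from
    MvPolynomial.eval₂Hom_congr' rfl (fun A hA _ => hj A hA) rfl]

open Cardinal in
theorem exists_surjective_trace_index :
    ∃ σ : ℝ → Finset ℝ × (Finset ℝ →₀ ℝ), Function.Surjective σ := by
  have h : #(Finset ℝ × (Finset ℝ →₀ ℝ)) = #ℝ := by
    rw [mk_prod, lift_id, lift_id, mk_finsupp_of_infinite, mk_finset_of_infinite, max_self,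
      mk_real, continuum_mul_self]
  obtain ⟨e⟩ := Cardinal.eq.1 h
  exact ⟨e.symm, e.symm.surjective⟩

/-! ### Strong algebrability from a family -/

/-- A family of elements all of whose nonzero polynomial expressions without constant term lie in
`A` witnesses strong algebrability. -/
theorem stronglyAlgebrable_of_family {R L κ : Type} [CommRing R] [Nontrivial R] [CommRing L]
    [Algebra R L] {A : Set L} (h0 : (0 : L) ∉ A) (F : κ → L)
    (hF : ∀ P : MvPolynomial κ R, MvPolynomial.constantCoeff P = 0 → P ≠ 0 →
      MvPolynomial.aeval F P ∈ A) :
    StronglyAlgebrable R (Cardinal.mk κ) A := by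
  have hinj : Function.Injective F := by
    intro i j hij
    by_contra hne
    refine h0 ?_
    have := hF (MvPolynomial.X i - MvPolynomial.X j) (by simp) fun h =>
      hne (MvPolynomial.X_injective (sub_eq_zero.1 h))
    simpa [hij] using this
  let X : Set L := Set.range F
  let e : κ ≃ X := Equiv.ofInjective F hinj
  have hX : ∀ P : MvPolynomial X R, MvPolynomial.constantCoeff P = 0 → P ≠ 0 →
      MvPolynomial.aeval (fun x : X => (x : L)) P ∈ A := by
    intro P hc hP
    have h1 : MvPolynomial.aeval F (MvPolynomial.rename e.symm P) =
        MvPolynomial.aeval (fun x : X => (x : L)) P := by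
      rw [MvPolynomial.aeval_rename]
      congr 2
      funext x
      exact congrArg Subtype.val (e.apply_symm_apply x)
    rw [← h1]
    refine hF _ (by rw [MvPolynomial.constantCoeff_rename, hc]) fun h => hP ?_
    exact MvPolynomial.rename_injective _ e.symm.injective (by rw [h, map_zero])
  -- Subtracting the constant term makes the claim hold for every `P`, so that induction applies.
  have hmem : ∀ P : MvPolynomial X R,
      MvPolynomial.aeval (fun x : X => (x : L)) P -
        algebraMap R L (MvPolynomial.constantCoeff P) ∈ NonUnitalAlgebra.adjoin R X := by
    intro P
    induction P using MvPolynomial.induction_on with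
    | C a => simp
    | add p q hp hq =>
      have := add_mem hp hq
      rw [map_add, map_add, map_add]
      convert this using 1
      ring
    | mul_X p x hp =>
      have hx : (x : L) ∈ NonUnitalAlgebra.adjoin R X :=
        NonUnitalAlgebra.subset_adjoin R x.2
      have := add_mem (mul_mem hp hx)
        (SMulMemClass.smul_mem (MvPolynomial.constantCoeff p) hx)
      convert this using 1
      simp [Algebra.smul_def]
      ring
  let ψ : freeCommAlgebra R X →ₙₐ[R] L :=
    (MvPolynomial.aeval (R := R) (fun x : X => (x : L))).toNonUnitalAlgHom.comp
      (NonUnitalSubalgebraClass.subtype (freeCommAlgebra R X))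
  have hψ : ∀ P, ψ P = MvPolynomial.aeval (fun x : X => (x : L)) P.1 := fun _ => rfl
  have hψmem : ∀ P, ψ P ∈ NonUnitalAlgebra.adjoin R X := by
    intro P
    have h := hmem P.1
    have hc : MvPolynomial.constantCoeff P.1 = 0 := P.2
    rwa [hc, map_zero, sub_zero] at h
  have hgen : ∀ x : X, ψ (freeCommAlgebraGen R x) = x := fun x =>
    MvPolynomial.aeval_X _ _
  have hrange : NonUnitalAlgebra.adjoin R X ≤ NonUnitalAlgHom.range ψ :=
    NonUnitalAlgebra.adjoin_le fun x hx => ⟨freeCommAlgebraGen R ⟨x, hx⟩, hgen ⟨x, hx⟩⟩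
  refine ⟨X, (Cardinal.mk_congr e).symm, ?_,
    NonUnitalAlgHom.codRestrict ψ _ hψmem, ⟨?_, ?_⟩, hgen⟩
  · intro y hy
    obtain ⟨P, rfl⟩ := hrange hy
    by_cases hP : P = 0
    · right
      simp [hP]
    · left
      exact hX P.1 P.2 fun h => hP (Subtype.ext h)
  · rw [NonUnitalAlgHom.injective_codRestrict]
    refine (injective_iff_map_eq_zero ψ).2 fun P hP => ?_
    by_contra hne
    refine h0 ?_
    rw [← hP]
    exact hX P.1 P.2 fun h => hne (Subtype.ext h)
  · rintro ⟨y, hy⟩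
    obtain ⟨P, rfl⟩ := hrange hy
    exact ⟨P, rfl⟩

/-! ### Increments of the Weierstrass function -/

/-- A Weierstrass function. -/
noncomputable def weierstrass (x : ℝ) : ℝ := ∑' k : ℕ, (1 / 16 : ℝ) ^ k * Real.cos (256 ^ k * x)

theorem norm_weierstrass_term_le (k : ℕ) (x : ℝ) :
    ‖(1 / 16 : ℝ) ^ k * Real.cos (256 ^ k * x)‖ ≤ (1 / 16 : ℝ) ^ k := by
  rw [norm_mul, Real.norm_of_nonneg (by positivity)]
  exact mul_le_of_le_one_right (by positivity) (Real.abs_cos_le_one _)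

theorem summable_weierstrass_bound : Summable fun k : ℕ => (1 / 16 : ℝ) ^ k :=
  summable_geometric_of_lt_one (by norm_num) (by norm_num)

theorem continuous_weierstrass : Continuous weierstrass :=
  continuous_tsum (fun k => by fun_prop) summable_weierstrass_bound norm_weierstrass_term_le

theorem summable_weierstrass (x : ℝ) :
    Summable fun k : ℕ => (1 / 16 : ℝ) ^ k * Real.cos (256 ^ k * x) :=
  .of_norm_bounded summable_weierstrass_bound fun k => norm_weierstrass_term_le k x

/-- Increments of the Weierstrass function along `θ / 256 ^ k` when the terms beyond the `k`-th
are periodic. -/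
theorem weierstrass_increment (k : ℕ) (x θ : ℝ) (n : ℤ) (hθ : 256 * θ = n * (2 * Real.pi)) :
    |weierstrass (x + θ / 256 ^ k) - weierstrass x -
      (1 / 16 : ℝ) ^ k * (Real.cos (256 ^ k * x + θ) - Real.cos (256 ^ k * x))| ≤
      (1 / 16 : ℝ) ^ k * (|θ| / 15) := by
  have hterm : weierstrass (x + θ / 256 ^ k) - weierstrass x =
      ∑ j ∈ Finset.range (k + 1), (1 / 16 : ℝ) ^ j *
        (Real.cos (256 ^ j * (x + θ / 256 ^ k)) - Real.cos (256 ^ j * x)) := by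
    unfold weierstrass
    rw [← (summable_weierstrass _).tsum_sub (summable_weierstrass _), tsum_eq_sum]
    · exact Finset.sum_congr rfl fun j _ => (mul_sub _ _ _).symm
    · intro j hj
      obtain ⟨i, rfl⟩ : ∃ i, j = k + 1 + i :=
        Nat.exists_eq_add_of_le (by simpa using hj)
      have : (256 : ℝ) ^ (k + 1 + i) * (x + θ / 256 ^ k) =
          256 ^ (k + 1 + i) * x + ((256 ^ i * n : ℤ) : ℝ) * (2 * Real.pi) := by
        push_cast
        rw [mul_assoc ((256 : ℝ) ^ i), ← hθ, pow_add, pow_succ]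
        field_simp
      rw [this, Real.cos_add_int_mul_two_pi, sub_self]
  have hk : (256 : ℝ) ^ k * (x + θ / 256 ^ k) = 256 ^ k * x + θ := by field_simp
  rw [hterm, Finset.sum_range_succ, hk, add_sub_cancel_right]
  -- Since 256 = 16², the terms before the `k`-th sum to at most a small multiple of the amplitude
  -- 16⁻ᵏ.
  calc _ ≤ ∑ j ∈ Finset.range k, 16 ^ j * (|θ| / 256 ^ k) := by
        refine (Finset.abs_sum_le_sum_abs _ _).trans (Finset.sum_le_sum fun j _ => ?_)
        rw [abs_mul, abs_of_nonneg (by positivity : (0 : ℝ) ≤ (1 / 16) ^ j)]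
        calc _ ≤ (1 / 16 : ℝ) ^ j * |256 ^ j * (x + θ / 256 ^ k) - 256 ^ j * x| := 
              mul_le_mul_of_nonneg_left (Real.abs_cos_sub_cos_le _ _) (by positivity)
          _ = (1 / 16 : ℝ) ^ j * (256 ^ j * (|θ| / 256 ^ k)) := by
              rw [← mul_sub, add_sub_cancel_left, abs_mul, abs_div,
                abs_of_nonneg (by positivity : (0 : ℝ) ≤ 256 ^ j),
                abs_of_nonneg (by positivity : (0 : ℝ) ≤ 256 ^ k)]
          _ = 16 ^ j * (|θ| / 256 ^ k) := by
              rw [← mul_assoc, ← mul_pow]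
              norm_num
    _ = (16 ^ k - 1) / 15 * (|θ| / 256 ^ k) := by
        rw [← Finset.sum_mul, geom_sum_eq (by norm_num)]
        norm_num
    _ ≤ 16 ^ k / 15 * (|θ| / 256 ^ k) := by
        gcongr
        linarith
    _ = (1 / 16 : ℝ) ^ k * (|θ| / 15) := by
        have : (256 : ℝ) ^ k = 16 ^ k * 16 ^ k := by rw [← mul_pow]; norm_num
        rw [this, one_div, inv_pow]
        field_simp

/-- Otherwise |cos y| < 1/4 and |sin y| < 3/4, so the squares sum to less than 1. -/
theorem half_le_abs_cos_increment (y : ℝ) :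
    1 / 2 ≤ |Real.cos (y + Real.pi) - Real.cos y| ∨
      1 / 2 ≤ |Real.cos (y + Real.pi / 2) - Real.cos y| := by
  rw [Real.cos_add_pi, Real.cos_add_pi_div_two]
  by_contra! h
  obtain ⟨h1, h2⟩ := h
  rw [abs_lt] at h1 h2
  have := Real.sin_sq_add_cos_sq y
  nlinarith

/-- At every point and at each scale, one of two increments of the Weierstrass function is large. -/
theorem weierstrass_increment_large (k : ℕ) (x : ℝ) :
    (1 / 16 : ℝ) ^ k / 4 ≤ |weierstrass (x + Real.pi / 256 ^ k) - weierstrass x| ∨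
      (1 / 16 : ℝ) ^ k / 4 ≤ |weierstrass (x + Real.pi / 2 / 256 ^ k) - weierstrass x| := by
  have key : ∀ (θ : ℝ) (n : ℤ), 256 * θ = n * (2 * Real.pi) → 0 ≤ θ → θ ≤ Real.pi →
      1 / 2 ≤ |Real.cos (256 ^ k * x + θ) - Real.cos (256 ^ k * x)| →
      (1 / 16 : ℝ) ^ k / 4 ≤ |weierstrass (x + θ / 256 ^ k) - weierstrass x| := by
    intro θ n hn h0 hpi hc
    have h := weierstrass_increment k x θ n hn
    have ha : (0 : ℝ) < (1 / 16) ^ k := by positivity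
    rw [abs_of_nonneg h0] at h
    have h1 : (1 / 16 : ℝ) ^ k * (1 / 2) ≤
        |(1 / 16 : ℝ) ^ k * (Real.cos (256 ^ k * x + θ) - Real.cos (256 ^ k * x))| := by
      rw [abs_mul, abs_of_pos ha]
      gcongr
    -- As π/15 < 1/4, the error takes at most half of the main term.
    have h2 : (1 / 16 : ℝ) ^ k * (θ / 15) ≤ (1 / 16 : ℝ) ^ k * (1 / 4) :=
      mul_le_mul_of_nonneg_left (by linarith [Real.pi_lt_d2]) ha.le
    have h3 := abs_sub_abs_le_abs_sub
      ((1 / 16 : ℝ) ^ k * (Real.cos (256 ^ k * x + θ) - Real.cos (256 ^ k * x)))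
      (weierstrass (x + θ / 256 ^ k) - weierstrass x)
    rw [abs_sub_comm] at h
    linarith
  have hpi := Real.pi_pos
  refine (half_le_abs_cos_increment (256 ^ k * x)).imp (fun h => ?_) fun h => ?_
  · exact key _ 128 (by push_cast; ring) hpi.le le_rfl h
  · exact key _ 64 (by push_cast; ring) (by positivity) (by linarith) h

/-! ### Agreement with a.e. differentiable functions -/

open Filter Topology in
theorem tendsto_volume_diff_translate {E : Set ℝ} (hE : MeasurableSet E) (hfin : volume E ≠ ⊤) :
    Tendsto (fun t : ℝ => volume (E \ (fun x => x + t) ⁻¹' E)) (𝓝 0) (𝓝 0) := by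
  let τ : ℝ → C(ℝ, ℝ) := fun t => ⟨fun x => x + t, by fun_prop⟩
  have hτ : Continuous τ :=
    ContinuousMap.continuous_of_continuous_uncurry _
      (by show Continuous fun p : ℝ × ℝ => p.2 + p.1; fun_prop)
  have hmp : ∀ t, MeasurePreserving (τ t) volume volume := fun t =>
    measurePreserving_add_right volume t
  have h := tendsto_measure_symmDiff_preimage_nhds_zero (hτ.tendsto 0)
    (.of_forall hmp) (hmp 0) hE.nullMeasurableSet hfin
  refine tendsto_of_tendsto_of_tendsto_of_le_of_le tendsto_const_nhds h (fun _ => zero_le)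
    fun t => measure_mono ?_
  have h0 : τ 0 ⁻¹' E = E := by
    ext x
    simp [τ]
  rw [h0]
  exact Set.subset_union_right

open Filter Topology in
/-- A set of positive measure contains `x`, `x + s`, `x + t` for some `x`, if `s`, `t` are small. -/
theorem exists_mem_translates {E : Set ℝ} (hE : MeasurableSet E) (hpos : volume E ≠ 0)
    {s t : ℕ → ℝ} (hs : Tendsto s atTop (𝓝 0)) (ht : Tendsto t atTop (𝓝 0)) :
    ∀ᶠ k in atTop, ∃ x ∈ E, x + s k ∈ E ∧ x + t k ∈ E := by
  obtain ⟨E', hE', hE'E, hpos', hfin⟩ :=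
    Measure.exists_subset_measure_lt_top hE (pos_iff_ne_zero.2 hpos)
  have h := tendsto_volume_diff_translate hE' hfin.ne
  have hsum := (h.comp hs).add (h.comp ht)
  rw [add_zero] at hsum
  filter_upwards [hsum.eventually_lt_const hpos'] with k hk
  have hlt := (measure_union_le _ _).trans_lt hk
  obtain ⟨x, hx, hnx⟩ := Set.not_subset.1 fun hsub => hlt.not_ge (measure_mono hsub)
  simp only [Set.mem_union, Set.mem_sdiff, Set.mem_preimage, hx, true_and, not_or,
    not_not] at hnx
  exact ⟨x, hE'E hx, hE'E hnx.1, hE'E hnx.2⟩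

-- Points of differentiability lie in the sets `D n` of uniform local Lipschitz bounds. If `E n` had
-- positive measure, it would contain some x with both translates x + π/256ᵏ and x + π/2/256ᵏ, where
-- the increments of g are O(256⁻ᵏ) but one of those of w is at least 16⁻ᵏ/4.
open Filter Topology in
theorem volume_eq_weierstrass_eq_zero {g : ℝ → ℝ} (hg : Continuous g)
    (hd : ∀ᵐ x, DifferentiableAt ℝ g x) : volume {x | g x = weierstrass x} = 0 := by
  let D : ℕ → Set ℝ := fun n => {x | ∀ y, |y - x| < 1 / (n + 1) → |g y - g x| ≤ n * |y - x|}
  let E : ℕ → Set ℝ := fun n => {x | g x = weierstrass x} ∩ D n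
  have hDclosed : ∀ n, IsClosed (D n) := by
    intro n
    have : D n = ⋂ y, ({x | 1 / ((n : ℝ) + 1) ≤ |y - x|} ∪ {x | |g y - g x| ≤ n * |y - x|}) := by
      ext x
      simp only [D, Set.mem_ofPred_eq, Set.mem_iInter, Set.mem_union, imp_iff_not_or,
        not_lt]
    rw [this]
    refine isClosed_iInter fun y => IsClosed.union ?_ ?_
    · exact isClosed_le (by fun_prop) (by fun_prop)
    · exact isClosed_le (by fun_prop) (by fun_prop)
  have hEmeas : ∀ n, MeasurableSet (E n) := fun n =>
    ((isClosed_eq hg continuous_weierstrass).inter (hDclosed n)).measurableSet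
  have hEnull : ∀ n, volume (E n) = 0 := by
    intro n
    by_contra hpos
    have hlim : ∀ θ : ℝ, Tendsto (fun k : ℕ => θ / 256 ^ k) atTop (𝓝 0) := fun θ =>
      tendsto_const_nhds.div_atTop (tendsto_pow_atTop_atTop_of_one_lt (by norm_num))
    have hbig : Tendsto (fun k : ℕ => (16 : ℝ) ^ k) atTop atTop :=
      tendsto_pow_atTop_atTop_of_one_lt (by norm_num)
    obtain ⟨k, ⟨x, hx, hx1, hx2⟩, hk1, hk2⟩ :=
      ((exists_mem_translates (hEmeas n) hpos (hlim Real.pi) (hlim (Real.pi / 2))).and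
        (((hlim Real.pi).eventually_lt_const
          (by positivity : (0 : ℝ) < 1 / ((n : ℝ) + 1))).and
          (hbig.eventually_gt_atTop (4 * n * Real.pi)))).exists
    have hpi := Real.pi_pos
    have hbound : ∀ θ : ℝ, 0 ≤ θ → θ ≤ Real.pi → x + θ / 256 ^ k ∈ E n →
        ¬ (1 / 16 : ℝ) ^ k / 4 ≤ |weierstrass (x + θ / 256 ^ k) - weierstrass x| := by
      intro θ h0 hθ hmem hle
      have hdist : |x + θ / 256 ^ k - x| = θ / 256 ^ k := by
        rw [add_sub_cancel_left, abs_of_nonneg (by positivity)]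
      have hθk : θ / 256 ^ k ≤ Real.pi / 256 ^ k := by gcongr
      have h := hx.2 (x + θ / 256 ^ k) (by rw [hdist]; exact hθk.trans_lt hk1)
      rw [hdist, show g x = weierstrass x from hx.1,
        show g (x + θ / 256 ^ k) = weierstrass (x + θ / 256 ^ k) from hmem.1] at h
      have h' : (1 / 16 : ℝ) ^ k / 4 ≤ n * (Real.pi / 256 ^ k) :=
        hle.trans (h.trans (by gcongr))
      have h256 : (256 : ℝ) ^ k = 16 ^ k * 16 ^ k := by rw [← mul_pow]; norm_num
      have hp : (0 : ℝ) < 16 ^ k := by positivity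
      rw [h256, one_div, inv_pow] at h'
      have := mul_le_mul_of_nonneg_left h' (by positivity : (0 : ℝ) ≤ 4 * (16 ^ k * 16 ^ k))
      field_simp at this
      nlinarith
    rcases weierstrass_increment_large k x with h | h
    · exact hbound _ hpi.le le_rfl hx1 h
    · exact hbound _ (by positivity) (by linarith) hx2 h
  have hcover : {x | g x = weierstrass x} ⊆ {x | ¬ DifferentiableAt ℝ g x} ∪ ⋃ n, E n := by
    intro x hx
    by_cases hxd : DifferentiableAt ℝ g x
    · right
      obtain ⟨C, hC⟩ := hxd.isBigO_sub.bound
      obtain ⟨δ, hδ, hball⟩ := Metric.eventually_nhds_iff.1 hC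
      obtain ⟨n₁, hn₁⟩ := exists_nat_ge C
      obtain ⟨n₂, hn₂⟩ := exists_nat_one_div_lt hδ
      refine Set.mem_iUnion.2 ⟨max n₁ n₂, hx, fun y hy => ?_⟩
      have h1 : |y - x| < δ := by
        refine hy.trans_le (le_trans ?_ hn₂.le)
        gcongr
        exact le_max_right _ _
      refine (hball h1).trans ?_
      gcongr
      · exact hn₁.trans (by exact_mod_cast le_max_left _ _)
      · exact le_rfl
    · exact Or.inl hxd
  refine measure_mono_null hcover (measure_union_null hd (measure_iUnion_null hEnull))

/-! ### The algebra of functions on the graph -/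

theorem mainTheorem4 (hA : ConditionA) :
    StronglyAlgebrable ℝ (2 ^ Cardinal.continuum)
      {F : ℝ × ℝ → ℝ | WeaklySupMeasurable F ∧ ¬ SupMeasurable F} := by
  classical
  obtain ⟨m, hm⟩ := exists_map_fibres_meet_positive
  obtain ⟨σ, hσ⟩ := exists_surjective_trace_index
  let F : Set ℝ → ℝ × ℝ → ℝ := fun A p =>
    if p.2 = weierstrass p.1 then traceValue A (σ (m p.1)) else 0
  rw [show (2 : Cardinal) ^ Cardinal.continuum = Cardinal.mk (Set ℝ) by
    rw [Cardinal.mk_set, Cardinal.mk_real]]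
  have hzero : SupMeasurable 0 := fun f _ => (measurable_const (a := (0 : ℝ))).nullMeasurable
  refine stronglyAlgebrable_of_family (fun h => h.2 hzero) F fun P hc hP => ?_
  have heval : ∀ p, MvPolynomial.aeval F P p = MvPolynomial.eval (fun A => F A p) P := by
    intro p
    have := MvPolynomial.comp_aeval_apply (f := F) (Pi.evalAlgHom ℝ (fun _ : ℝ × ℝ => ℝ) p) P
    exact this
  have hoff : ∀ x y, y ≠ weierstrass x → MvPolynomial.aeval F P (x, y) = 0 := by
    intro x y hxy
    rw [heval]
    simp only [F, hxy, if_false]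
    exact (DFunLike.congr_fun MvPolynomial.eval_zero' P).trans hc
  have hon : ∀ x, MvPolynomial.aeval F P (x, weierstrass x) =
      MvPolynomial.eval (fun A => traceValue A (σ (m x))) P := by
    intro x
    rw [heval]
    simp only [F, if_true]
  constructor
  · intro g hg hd
    have hae : (fun _ => (0 : ℝ)) =ᵐ[volume] superposition (MvPolynomial.aeval F P) g := by
      have hnull := volume_eq_weierstrass_eq_zero hg hd
      rw [measure_eq_zero_iff_ae_notMem] at hnull
      filter_upwards [hnull] with x hx
      exact (hoff x (g x) hx).symm
    exact (measurable_const (a := (0 : ℝ))).nullMeasurable.congr hae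
  · intro hsup
    have hmeas := hsup weierstrass continuous_weierstrass.measurable.nullMeasurable
    obtain ⟨j, hj⟩ := exists_eval_traceValue_ne_zero hP
    obtain ⟨c, rfl⟩ := hσ j
    -- At this index all generators vanish, so `P` takes its constant term 0.
    obtain ⟨c₀, hc₀⟩ := hσ (∅, 0)
    let S : Set ℝ := superposition (MvPolynomial.aeval F P) weierstrass ⁻¹' {0}
    have hS : NullMeasurableSet S volume := hmeas (measurableSet_singleton 0)
    have hmeet : ∀ T : Set ℝ, NullMeasurableSet T volume → volume T ≠ 0 →
        ∀ c, ∃ x ∈ T, m x = c := by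
      intro T hT hpos c
      obtain ⟨T', hT'T, hT', hae⟩ := hT.exists_measurable_subset_ae_eq
      rw [← measure_congr hae] at hpos
      obtain ⟨x, hx, hxc⟩ := hm T' hT' (pos_iff_ne_zero.2 hpos) c
      exact ⟨x, hT'T hx, hxc⟩
    have hSnull : volume S = 0 := by
      by_contra hpos
      obtain ⟨x, hx, rfl⟩ := hmeet S hS hpos c
      exact hj ((hon x).symm.trans hx)
    have hScnull : volume Sᶜ = 0 := by
      by_contra hpos
      obtain ⟨x, hx, rfl⟩ := hmeet Sᶜ hS.compl hpos c₀
      refine hx ((hon x).trans ?_)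
      rw [hc₀]
      exact (DFunLike.congr_fun MvPolynomial.eval_zero' P).trans hc
    have huniv := measure_union_null hSnull hScnull
    rw [Set.union_compl_self] at huniv
    simp at huniv
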